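/- Let $L=L_1\cup\dots\cup L_n$ be an oriented (smooth) link in $S^3$ with integer multiplicities $\underline m=(m_1,\dots,m_n)$ on its components (a multilink $L(\underline m)$), and let $X$ be its exterior, the complement in $S^3$ of an open tubular neighbourhood of $L$. The multiplicities determine a homotopy class of maps $X\to S^1$: those with degree $m_i$ on the positively oriented meridian of $L_i$, for all $i$. For any map $\phi_0$ in this class let $\widetilde X=\{(x,r)\in X\times\mathbb R : \phi_0(x)=e^{2\pi i r}\}$ be the corresponding infinite cyclic covering; the Alexander module of $L(\underline m)$ is $A=H_1(\widetilde X;\mathbb Z)$, a $\mathbb Z[t^{\pm1}]$-module where $t$ acts by the map induced by $(x,r)\mapsto(x,r+1)$. A $k\times l$ presentation matrix of $A$ is the matrix $P$ of a presentation with $l$ generators (columns) and $k$ relations (rows), and the Alexander polynomial of $L(\underline m)$ is the greatest common divisor of the $l\times l$ minors of any such $P$, up to multiplication by units of $\mathbb Z[t^{\pm1}]$. Suppose that $L(\underline m)$ is fibered, that is, that there is a locally trivial fibration $\varphi\colon X\to S^1$ in the homotopy class $\underline m$. Let $F=\varphi^{-1}(1)$. Then $\varphi$ has a monodromy: a homeomorphism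 $h\colon F\to F$ for which there is a homeomorphism $F\times\mathbb R\to\{(x,r)\in X\times\mathbb R : \varphi(x)=e^{2\pi i r}\}$ over $\mathbb R$, equal to $x\mapsto(x,0)$ on $F\times\{0\}$, conjugating $(x,r)\mapsto(x,r+1)$ to $(x,z)\mapsto(h(x),z+1)$. For every monodromy $h$ and every matrix $H$ of $h_*\colon H_1(F;\mathbb Z)\to H_1(F;\mathbb Z)$ with respect to a finite $\mathbb Z$-basis of $H_1(F;\mathbb Z)$, the matrix $H^T-tI$ is a presentation matrix of the Alexander module $A$ of $L(\underline m)$. In particular, the Alexander polynomial of $L(\underline m)$ is the characteristic polynomial $\det(tI-H)$ of the monodromy, up to multiplication by units. -/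

import Mathlib

open scoped ContDiff LaurentPolynomial

noncomputable section

/-! ### Oriented links, multilinks and their exteriors -/

/-- The 3-sphere, as the unit sphere of `ℝ⁴`. -/
abbrev S3 : Type := Metric.sphere (0 : EuclideanSpace ℝ (Fin 4)) 1

/-- An oriented link with `n` components in `S³`: disjoint smooth embeddings of the circle, the
orientation of each component being the one of its parametrization. -/
structure OrientedLink (n : ℕ) where
  comp : Fin n → Circle → S3
  smooth : ∀ i, ContDiff ℝ ∞
    (fun s : ℝ => (comp i (Circle.exp s) : EuclideanSpace ℝ (Fin 4)))
  immersion : ∀ i (s : ℝ),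
    deriv (fun s : ℝ => (comp i (Circle.exp s) : EuclideanSpace ℝ (Fin 4))) s ≠ 0
  injective : Function.Injective (fun p : Fin n × Circle => comp p.1 p.2)

/-- A multilink: an oriented link with an integer multiplicity on each component. -/
structure Multilink (n : ℕ) extends OrientedLink n where
  mult : Fin n → ℤ

/-- The map `ℝ × ℂ → ℝ⁴`, `(s, w) ↦ T (e^{is}, w)` underlying `T : S¹ × ℂ → S³`. -/
def liftTube (T : Circle × ℂ → S3) (p : ℝ × ℂ) : EuclideanSpace ℝ (Fin 4) :=
  (T (Circle.exp p.1, p.2) : EuclideanSpace ℝ (Fin 4))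

/-- A tubular neighbourhood of an oriented link: disjoint smooth, orientation preserving open
embeddings of `S¹ × ℂ` in `S³` that restrict to the components of the link on `S¹ × {0}`.
`S³` is oriented as the boundary of the unit ball (outward normal first), so that the frame
`∂/∂s, ∂/∂x, ∂/∂y` is sent to a positive frame of `S³` exactly if the determinant is positive. -/
structure TubularNeighborhood {n : ℕ} (L : OrientedLink n) where
  tube : Fin n → Circle × ℂ → S3
  core : ∀ i z, tube i (z, 0) = L.comp i z
  isOpenEmbedding : ∀ i, Topology.IsOpenEmbedding (tube i)
  disjoint : Pairwise fun i j => Disjoint (Set.range (tube i)) (Set.range (tube j))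
  smooth : ∀ i, ContDiff ℝ ∞ (liftTube (tube i))
  orientation : ∀ i (p : ℝ × ℂ),
    0 < Matrix.det (Matrix.of ![
      (fun k => liftTube (tube i) p k),
      (fun k => fderiv ℝ (liftTube (tube i)) p (1, 0) k),
      (fun k => fderiv ℝ (liftTube (tube i)) p (0, 1) k),
      (fun k => fderiv ℝ (liftTube (tube i)) p (0, Complex.I) k)] : Matrix (Fin 4) (Fin 4) ℝ)

namespace TubularNeighborhood

variable {n : ℕ} {L : OrientedLink n} (N : TubularNeighborhood L)

/-- The exterior of the link: the complement in `S³` of the open tubes of radius one. -/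
def exterior : Set S3 :=
  (⋃ i, N.tube i '' (Set.univ ×ˢ Metric.ball (0 : ℂ) 1))ᶜ

lemma tube_mem_exterior (i : Fin n) (z : Circle) (w : ℂ) (hw : ‖w‖ = 1) :
    N.tube i (z, w) ∈ N.exterior := by
  simp only [exterior, Set.mem_compl_iff, Set.mem_iUnion, not_exists]
  rintro j ⟨⟨z', w'⟩, ⟨-, hw'⟩, h⟩
  rcases eq_or_ne j i with rfl | hji
  · have := (N.isOpenEmbedding j).injective h
    simp only [Prod.mk.injEq] at this
    simp [this.2, hw] at hw'
  · exact Set.disjoint_left.1 (N.disjoint hji) ⟨_, h⟩ ⟨_, rfl⟩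

/-- The positively oriented meridian of the `i`-th component, on the boundary of the exterior. -/
def meridian (i : Fin n) : C(Circle, N.exterior) where
  toFun w := ⟨N.tube i (1, (w : ℂ)), N.tube_mem_exterior i 1 w w.norm_coe⟩
  continuous_toFun := by
    refine Continuous.subtype_mk ((N.isOpenEmbedding i).continuous.comp ?_) _
    fun_prop

end TubularNeighborhood

/-- The map `z ↦ z ^ k` from the circle to itself. -/
def circlePow (k : ℤ) : C(Circle, Circle) := ⟨fun z => z ^ k, continuous_zpow k⟩

/-- The homotopy class of maps `X → S¹` given by multiplicities `m`, where `X` is the exterior: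
the maps whose degree on the meridian of the `i`-th component is `m i` for every `i`. -/
def homotopyClass {n : ℕ} {L : OrientedLink n} (N : TubularNeighborhood L) (m : Fin n → ℤ) :
    Set C(N.exterior, Circle) :=
  {φ | ∀ i, (φ.comp (N.meridian i)).Homotopic (circlePow (m i))}

/-! ### The infinite cyclic covering, fibrations and their monodromy -/

section Covering

variable {X : Type} [TopologicalSpace X]

/-- The pullback along `φ` of the covering `ℝ → S¹`, `r ↦ exp (2πir)`. -/
def CyclicCover (φ : C(X, Circle)) : Type :=
  {p : X × ℝ // φ p.1 = Circle.exp (2 * Real.pi * p.2)}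

instance (φ : C(X, Circle)) : TopologicalSpace (CyclicCover φ) :=
  inferInstanceAs (TopologicalSpace {p : X × ℝ // φ p.1 = Circle.exp (2 * Real.pi * p.2)})

/-- The generator `(x, r) ↦ (x, r + 1)` of the group of the covering. -/
def deckGenerator (φ : C(X, Circle)) : CyclicCover φ ≃ₜ CyclicCover φ where
  toFun p := ⟨(p.1.1, p.1.2 + 1), by rw [p.2, mul_add, mul_one, Circle.exp_add_two_pi]⟩
  invFun p := ⟨(p.1.1, p.1.2 - 1), by rw [p.2, mul_sub, mul_one, Circle.exp_sub_two_pi]⟩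
  left_inv p := by apply Subtype.ext; simp
  right_inv p := by apply Subtype.ext; simp
  continuous_toFun := by
    refine Continuous.subtype_mk ?_ _
    have : Continuous (fun p : CyclicCover φ => p.1) := continuous_subtype_val
    fun_prop
  continuous_invFun := by
    refine Continuous.subtype_mk ?_ _
    have : Continuous (fun p : CyclicCover φ => p.1) := continuous_subtype_val
    fun_prop

/-- The map is a locally trivial fibration. -/
def IsLocallyTrivialFibration (φ : C(X, Circle)) : Prop :=
  ∃ (G : Type) (_ : TopologicalSpace G), ∀ b : Circle,
    ∃ e : Bundle.Trivialization G (φ : X → Circle), b ∈ e.baseSet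

/-- The fiber `φ⁻¹(1)`. -/
abbrev fiber (φ : C(X, Circle)) : Type := {x : X // φ x = 1}

/-- The inclusion of the fiber in the covering at height zero. -/
def fiberInclusion (φ : C(X, Circle)) (x : fiber φ) : CyclicCover φ :=
  ⟨(x.1, 0), by simp [x.2]⟩

/-- `h` is a monodromy of `φ`: there is a homeomorphism from `F × ℝ` to the infinite cyclic
covering, over `ℝ` and equal to the inclusion on `F × {0}`, which conjugates the generator of the
group of the covering to `(x, z) ↦ (h x, z + 1)`. -/
def IsMonodromy (φ : C(X, Circle)) (h : fiber φ ≃ₜ fiber φ) : Prop :=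
  ∃ Ψ : fiber φ × ℝ ≃ₜ CyclicCover φ,
    (∀ x z, (Ψ (x, z)).1.2 = z) ∧
    (∀ x, Ψ (x, 0) = fiberInclusion φ x) ∧
    ∀ x z, deckGenerator φ (Ψ (x, z)) = Ψ (h x, z + 1)

end Covering

/-! ### Homology -/

/-- The first singular homology functor with integer coefficients. -/
abbrev H1Functor : CategoryTheory.Functor TopCat.{0} (ModuleCat.{0} ℤ) :=
  (AlgebraicTopology.singularHomologyFunctor (ModuleCat.{0} ℤ) 1).obj (ModuleCat.of ℤ ℤ)

/-- The first singular homology group of `X` with integer coefficients. -/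
abbrev H1 (X : Type) [TopologicalSpace X] : Type := H1Functor.obj (TopCat.of X)

/-- The automorphism of `H₁(X)` induced by a homeomorphism from `X` to itself. -/
def H1.aut {X : Type} [TopologicalSpace X] (h : X ≃ₜ X) : H1 X ≃ₗ[ℤ] H1 X :=
  (H1Functor.mapIso (TopCat.isoOfHomeo h)).toLinearEquiv

/-! ### Modules over `ℤ[t, t⁻¹]` -/

section Laurent

variable {M : Type} [AddCommGroup M] [Module ℤ M]

/-- The ring homomorphism `ℤ[t, t⁻¹] → End M` sending `t` to a given automorphism of `M`. -/
def laurentToEnd (e : M ≃ₗ[ℤ] M) : ℤ[T;T⁻¹] →+* Module.End ℤ M :=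
  (AddMonoidAlgebra.lift ℤ (Module.End ℤ M) ℤ ((Units.coeHom (Module.End ℤ M)).comp
    (zpowersHom _ (LinearMap.GeneralLinearGroup.ofLinearEquiv e)))).toRingHom

/-- The abelian group `M`, as a `ℤ[t, t⁻¹]`-module on which `t` acts as `e`. -/
def LaurentModule (_e : M ≃ₗ[ℤ] M) : Type := M

instance (e : M ≃ₗ[ℤ] M) : AddCommGroup (LaurentModule e) := inferInstanceAs (AddCommGroup M)

instance (e : M ≃ₗ[ℤ] M) : Module ℤ[T;T⁻¹] (LaurentModule e) :=
  Module.compHom M (laurentToEnd e)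

theorem LaurentModule.T_smul (e : M ≃ₗ[ℤ] M) (x : M) :
    (LaurentPolynomial.T 1 : ℤ[T;T⁻¹]) • (show LaurentModule e from x) = e x := by
  change laurentToEnd e (LaurentPolynomial.T 1) x = e x
  have h := AddMonoidAlgebra.lift_single (R := ℤ) (A := Module.End ℤ M)
    ((Units.coeHom (Module.End ℤ M)).comp
      (zpowersHom _ (LinearMap.GeneralLinearGroup.ofLinearEquiv e))) (1 : ℤ) (1 : ℤ)
  refine (congrArg (fun g : Module.End ℤ M => g x) h).trans ?_
  rw [one_smul]
  simp

end Laurent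

/-- The Alexander module `H₁` of the infinite cyclic covering defined by `φ`, where `t` acts by the
generator `(x, r) ↦ (x, r + 1)`. The Alexander module of a multilink is obtained from any `φ` in the
homotopy class of maps on the exterior given by the multiplicities. -/
abbrev AlexanderModule {X : Type} [TopologicalSpace X] (φ : C(X, Circle)) : Type :=
  LaurentModule (H1.aut (deckGenerator φ))

/-- `P` is a presentation matrix of `A`, with one row for each of the `k` relations and one column
for each of the `l` generators: there is an exact sequence `Rᵏ → Rˡ → A → 0` whose first map sends
the `i`-th basis vector to the `i`-th row of `P`. -/
def IsPresentationMatrix {R : Type} [CommRing R] {k l : ℕ} (P : Matrix (Fin k) (Fin l) R)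
    (A : Type) [AddCommGroup A] [Module R A] : Prop :=
  ∃ f : (Fin l → R) →ₗ[R] A, Function.Exact P.vecMulLinear f ∧ Function.Surjective f

/-- `Δ` is a greatest common divisor of the `l × l` minors of the `k × l` matrix `P`. -/
def IsGCDOfMinors {R : Type} [CommRing R] {k l : ℕ} (P : Matrix (Fin k) (Fin l) R) (Δ : R) :
    Prop :=
  ∀ x : R, x ∣ Δ ↔ ∀ r : Fin l ↪o Fin k, x ∣ (P.submatrix r id).det

/-- `Δ` is the Alexander polynomial (up to units) of a `ℤ[t, t⁻¹]`-module `A`: `A` has a finite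
presentation, and `Δ` is a greatest common divisor of the maximal minors of every presentation
matrix, of size the number of generators. -/
def IsAlexanderPolynomial (A : Type) [AddCommGroup A] [Module ℤ[T;T⁻¹] A] (Δ : ℤ[T;T⁻¹]) : Prop :=
  (∃ (k l : ℕ) (P : Matrix (Fin k) (Fin l) ℤ[T;T⁻¹]), IsPresentationMatrix P A) ∧
  ∀ (k l : ℕ) (P : Matrix (Fin k) (Fin l) ℤ[T;T⁻¹]), IsPresentationMatrix P A → IsGCDOfMinors P Δ

end

/-! Two maps `φ`, `φ₀` in the class `m` are homotopic: their quotient is null-homotopic on the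
meridians, hence extends over the tubes to the whole sphere `S³`, where every map to the circle has
a continuous logarithm. A homotopy yields `φ = φ₀ · exp (2πi g)` with `g` real-valued, and the
translation `(x, r) ↦ (x, r - g x)` identifies the two cyclic coverings, so the Alexander module may
be computed from the fibration. Its covering is `F × ℝ` with `t` acting by `(x, z) ↦ (h x, z + 1)`,
whence `A` is `H₁(F)` with `t` acting by `h_*`; such a module is presented by `Hᵀ - t I`.

The `l × l` minors of a presentation matrix with `l` generators generate the initial Fitting ideal
of the module, which does not depend on the presentation. It is here generated by `det (Hᵀ - t I)`,
so this determinant is the greatest common divisor of the minors of every presentation.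

The pullback of the fibration to `ℝ` is trivial over `[0, 1]`, and extending a trivialization there
equivariantly under the deck transformation exhibits a monodromy. -/

noncomputable section

/-! ### Fitting ideals -/

section Fitting

open Matrix

variable {R : Type*} [CommRing R]

lemma det_fromBlocks_one_sub_mul {ι κ : Type*} [Fintype ι] [DecidableEq ι] [Fintype κ]
    [DecidableEq κ] (N : Matrix ι ι R) (C : Matrix ι κ R) (D : Matrix κ ι R) :
    (fromBlocks (1 - D * C) (-D) (N * C) N).det = N.det := by
  have hfactor : fromBlocks (1 - D * C) (-D) (N * C) N =
      fromBlocks 1 (-D) 0 N * fromBlocks 1 0 C 1 := by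
    simp [fromBlocks_multiply, sub_eq_add_neg]
  rw [hfactor, det_mul, det_fromBlocks_zero₂₁, det_fromBlocks_zero₁₂]
  simp

lemma det_mul_eq_sum_det_submatrix {ι κ : Type*} [Fintype ι] [DecidableEq ι] [Fintype κ]
    (V : Matrix ι κ R) (P : Matrix κ ι R) :
    (V * P).det = ∑ r : ι → κ, (∏ i, V i (r i)) * (P.submatrix r id).det := by
  classical
  have hrows : V * P = fun i => ∑ j, V i j • P j := by
    ext i c
    simp [mul_apply]
  calc (V * P).det
      = ∑ r : ι → κ, detRowAlternating.toMultilinearMap fun i => V i (r i) • P (r i) := by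
        rw [hrows]
        exact detRowAlternating.toMultilinearMap.map_sum fun i j => V i j • P j
    _ = ∑ r : ι → κ, (∏ i, V i (r i)) * (P.submatrix r id).det :=
        Finset.sum_congr rfl fun r _ =>
          detRowAlternating.toMultilinearMap.map_smul_univ (fun i => V i (r i)) fun i => P (r i)

lemma dvd_det_submatrix_of_dvd_minors {k l : ℕ} {P : Matrix (Fin k) (Fin l) R} {x : R}
    (hx : ∀ r : Fin l ↪o Fin k, x ∣ (P.submatrix r id).det) (r : Fin l → Fin k) :
    x ∣ (P.submatrix r id).det := by
  by_cases hr : Function.Injective r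
  · let s : Fin l ↪o Fin k := OrderEmbedding.ofStrictMono (r ∘ Tuple.sort r)
      ((Tuple.monotone_sort r).strictMono_of_injective (hr.comp (Tuple.sort r).injective))
    have hs : x ∣ ((P.submatrix r id).submatrix (Tuple.sort r) id).det := hx s
    rw [det_permute] at hs
    exact ((Equiv.Perm.sign (Tuple.sort r)).isUnit.map (Int.castRingHom R)).dvd_mul_left.1 hs
  · obtain ⟨i, j, hij, hne⟩ : ∃ i j, r i = r j ∧ i ≠ j := by
      simpa only [Function.Injective, not_forall, exists_prop] using hr
    rw [det_zero_of_row_eq hne (by ext; simp [hij])]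
    exact dvd_zero x

lemma dvd_det_mul_of_dvd_minors {k l : ℕ} {P : Matrix (Fin k) (Fin l) R} {x : R}
    (hx : ∀ r : Fin l ↪o Fin k, x ∣ (P.submatrix r id).det) (V : Matrix (Fin l) (Fin k) R) :
    x ∣ (V * P).det := by
  rw [det_mul_eq_sum_det_submatrix]
  exact Finset.dvd_sum fun r _ => (dvd_det_submatrix_of_dvd_minors hx r).mul_left _

variable {A : Type*} [AddCommGroup A] [Module R A]

/-- The initial Fitting ideal of a module with generators given by `f`: the ideal generated by the
determinants of the square matrices whose rows are relations between these generators. -/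
def fittingIdeal {l : ℕ} (f : (Fin l → R) →ₗ[R] A) : Ideal R :=
  Ideal.span {d | ∃ N : Matrix (Fin l) (Fin l) R, (∀ i, f (N i) = 0) ∧ N.det = d}

lemma det_mem_fittingIdeal {l : ℕ} {f : (Fin l → R) →ₗ[R] A} {N : Matrix (Fin l) (Fin l) R}
    (hN : ∀ i, f (N i) = 0) : N.det ∈ fittingIdeal f :=
  Ideal.subset_span ⟨N, hN, rfl⟩

lemma fittingIdeal_le_iff {l : ℕ} {f : (Fin l → R) →ₗ[R] A} {I : Ideal R} :
    fittingIdeal f ≤ I ↔ ∀ N : Matrix (Fin l) (Fin l) R, (∀ i, f (N i) = 0) → N.det ∈ I := by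
  refine Ideal.span_le.trans ⟨fun h N hN => h ⟨N, hN, rfl⟩, ?_⟩
  rintro h _ ⟨N, hN, rfl⟩
  exact h N hN

lemma det_mem_fittingIdeal_of_castAdd {l : ℕ} {f : (Fin l → R) →ₗ[R] A} (n : ℕ)
    (M : Matrix (Fin (l + n)) (Fin (l + n)) R) (hM : ∀ i, f (fun j => M i (Fin.castAdd n j)) = 0) :
    M.det ∈ fittingIdeal f := by
  induction n with
  | zero => exact det_mem_fittingIdeal hM
  | succ n ih =>
    rw [det_succ_column (n := l + n) M (Fin.last _)]
    refine Ideal.sum_mem _ fun i _ => Ideal.mul_mem_left _ _ (ih _ fun k => ?_)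
    simp only [submatrix_apply, Fin.succAbove_last]
    exact hM (i.succAbove k)

lemma exists_matrix_map_vecMul_eq {ι κ : Type*} [Fintype ι] {g : (κ → R) →ₗ[R] A}
    (hg : Function.Surjective g) (f : (ι → R) →ₗ[R] A) :
    ∃ C : Matrix ι κ R, ∀ v, g (v ᵥ* C) = f v := by
  classical
  choose C hC using fun i : ι => hg (f (Pi.single i 1))
  have hcomp : g ∘ₗ (Matrix.of C).vecMulLinear = f := LinearMap.pi_ext' fun i =>
    LinearMap.ext_ring ((congrArg g (single_one_vecMul i (Matrix.of C))).trans (hC i))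
  exact ⟨Matrix.of C, LinearMap.congr_fun hcomp⟩

lemma fittingIdeal_le {l m : ℕ} {f : (Fin l → R) →ₗ[R] A} {g : (Fin m → R) →ₗ[R] A}
    (hf : Function.Surjective f) (hg : Function.Surjective g) :
    fittingIdeal f ≤ fittingIdeal g := by
  refine fittingIdeal_le_iff.2 fun N hN => ?_
  obtain ⟨C, hC⟩ := exists_matrix_map_vecMul_eq hg f
  obtain ⟨D, hD⟩ := exists_matrix_map_vecMul_eq hf g
  let M := fromBlocks (1 - D * C) (-D) (N * C) N
  have hM : ∀ i, g (fun j => M i (Sum.inl j)) = 0 := by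
    rintro (i | i)
    · have hrow : (fun j => M (Sum.inl i) (Sum.inl j)) =
          Pi.single i 1 - Pi.single i 1 ᵥ* D ᵥ* C := by
        ext j
        simp [M, one_apply, Pi.single_apply, mul_apply_eq_vecMul, eq_comm, row_def]
      rw [hrow, map_sub, hC, hD, sub_self]
    · exact (hC (N i)).trans (hN i)
  have hdet : (M.reindex finSumFinEquiv finSumFinEquiv).det = N.det :=
    (det_reindex_self _ _).trans (det_fromBlocks_one_sub_mul N C D)
  rw [← hdet]
  refine det_mem_fittingIdeal_of_castAdd l _ fun i => ?_
  simpa using hM (finSumFinEquiv.symm i)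

lemma fittingIdeal_eq {l m : ℕ} {f : (Fin l → R) →ₗ[R] A} {g : (Fin m → R) →ₗ[R] A}
    (hf : Function.Surjective f) (hg : Function.Surjective g) :
    fittingIdeal f = fittingIdeal g :=
  (fittingIdeal_le hf hg).antisymm (fittingIdeal_le hg hf)

section Exact

variable {ι κ : Type*} [Fintype κ] {P : Matrix κ ι R} {f : (ι → R) →ₗ[R] A}

lemma exists_eq_mul_of_exact {ν : Type*} (hP : Function.Exact P.vecMulLinear f)
    {N : Matrix ν ι R} (hN : ∀ i, f (N i) = 0) : ∃ V : Matrix ν κ R, N = V * P := by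
  choose V hV using fun i => (hP (N i)).1 (hN i)
  exact ⟨Matrix.of V, Matrix.ext fun i j => (congrFun (hV i) j).symm⟩

lemma map_row_eq_zero_of_exact (hP : Function.Exact P.vecMulLinear f) (i : κ) : f (P i) = 0 := by
  classical
  exact (hP (P i)).2 ⟨Pi.single i 1, by simp [row]⟩

end Exact

lemma fittingIdeal_eq_span_det {l : ℕ} {Q : Matrix (Fin l) (Fin l) R} {f : (Fin l → R) →ₗ[R] A}
    (hQ : Function.Exact Q.vecMulLinear f) : fittingIdeal f = Ideal.span {Q.det} := by
  refine le_antisymm (fittingIdeal_le_iff.2 fun N hN => ?_) ?_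
  · obtain ⟨V, rfl⟩ := exists_eq_mul_of_exact hQ hN
    exact Ideal.mem_span_singleton.2 (det_mul V Q ▸ dvd_mul_left _ _)
  · exact (Ideal.span_singleton_le_iff_mem _).2
      (det_mem_fittingIdeal (map_row_eq_zero_of_exact hQ))

end Fitting

section PresentationMatrix

variable {R : Type} [CommRing R] {A B : Type} [AddCommGroup A] [Module R A] [AddCommGroup B]
  [Module R B] {k l : ℕ}

lemma isGCDOfMinors_of_fittingIdeal_eq {P : Matrix (Fin k) (Fin l) R} {f : (Fin l → R) →ₗ[R] A}
    (hP : Function.Exact P.vecMulLinear f) {Δ : R} (hΔ : fittingIdeal f = Ideal.span {Δ}) :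
    IsGCDOfMinors P Δ := by
  refine fun x => ⟨fun hx r => hx.trans ?_, fun hx => ?_⟩
  · rw [← Ideal.mem_span_singleton, ← hΔ]
    exact det_mem_fittingIdeal fun i => map_row_eq_zero_of_exact hP (r i)
  · rw [← Ideal.mem_span_singleton, ← Ideal.span_singleton_le_iff_mem, ← hΔ]
    refine fittingIdeal_le_iff.2 fun N hN => ?_
    obtain ⟨V, rfl⟩ := exists_eq_mul_of_exact hP hN
    exact Ideal.mem_span_singleton.2 (dvd_det_mul_of_dvd_minors hx V)

lemma IsPresentationMatrix.isGCDOfMinors {m : ℕ} {P : Matrix (Fin k) (Fin l) R}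
    (hP : IsPresentationMatrix P A) {Q : Matrix (Fin m) (Fin m) R}
    (hQ : IsPresentationMatrix Q A) {Δ : R} (hΔ : Associated Q.det Δ) : IsGCDOfMinors P Δ := by
  obtain ⟨f, hf, hf_surj⟩ := hP
  obtain ⟨g, hg, hg_surj⟩ := hQ
  obtain ⟨u, rfl⟩ := hΔ
  refine isGCDOfMinors_of_fittingIdeal_eq hf ?_
  rw [fittingIdeal_eq hf_surj hg_surj, fittingIdeal_eq_span_det hg,
    Ideal.span_singleton_mul_right_unit u.isUnit]

lemma IsPresentationMatrix.isAlexanderPolynomial {A : Type} [AddCommGroup A]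
    [Module ℤ[T;T⁻¹] A] {Q : Matrix (Fin l) (Fin l) ℤ[T;T⁻¹]}
    (hQ : IsPresentationMatrix Q A) {Δ : ℤ[T;T⁻¹]} (hΔ : Associated Q.det Δ) :
    IsAlexanderPolynomial A Δ :=
  ⟨⟨l, l, Q, hQ⟩, fun _ _ _ hP => hP.isGCDOfMinors hQ hΔ⟩

lemma IsPresentationMatrix.congr {P : Matrix (Fin k) (Fin l) R} (hP : IsPresentationMatrix P A)
    (e : A ≃ₗ[R] B) : IsPresentationMatrix P B := by
  obtain ⟨f, hf, hf_surj⟩ := hP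
  exact ⟨e.toLinearMap ∘ₗ f, fun x => by simpa using hf x, e.surjective.comp hf_surj⟩

end PresentationMatrix

/-! ### Modules over `ℤ[t, t⁻¹]` given by an automorphism -/

section Laurent

open LaurentPolynomial Matrix

lemma map_laurent_smul_of_map_T_smul {A B : Type*} [AddCommGroup A] [Module ℤ[T;T⁻¹] A]
    [AddCommGroup B] [Module ℤ[T;T⁻¹] B] (σ : A →+ B)
    (hσ : ∀ x, σ ((T 1 : ℤ[T;T⁻¹]) • x) = (T 1 : ℤ[T;T⁻¹]) • σ x) (p : ℤ[T;T⁻¹]) (x : A) :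
    σ (p • x) = p • σ x := by
  have hσ_inv : ∀ x, σ ((T (-1) : ℤ[T;T⁻¹]) • x) = (T (-1) : ℤ[T;T⁻¹]) • σ x := by
    intro x
    have h := hσ ((T (-1) : ℤ[T;T⁻¹]) • x)
    rw [smul_smul, ← T_add, add_neg_cancel, T_zero, one_smul] at h
    rw [h, smul_smul, ← T_add, neg_add_cancel, T_zero, one_smul]
  induction p using LaurentPolynomial.induction_on generalizing x with
  | h_C a => simp only [eq_intCast, Int.cast_smul_eq_zsmul, map_zsmul]
  | h_add hp hq => rw [add_smul, add_smul, map_add, hp, hq]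
  | h_C_mul_T n a h => rw [T_add, ← mul_assoc, mul_smul, h, hσ, mul_smul _ (T 1)]
  | h_C_mul_T_Z n a h =>
    rw [sub_eq_add_neg, T_add, ← mul_assoc, mul_smul, h, hσ_inv, mul_smul _ (T (-1))]

lemma C_smul_eq_zsmul {A : Type*} [AddCommGroup A] [Module ℤ[T;T⁻¹] A] (a : ℤ) (x : A) :
    (C a : ℤ[T;T⁻¹]) • x = a • x := by
  rw [eq_intCast, Int.cast_smul_eq_zsmul]

variable {M M' : Type} [AddCommGroup M] [Module ℤ M] [AddCommGroup M'] [Module ℤ M']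

/-- The identity of `M`, as a map to the type synonym `LaurentModule e`. -/
def LaurentModule.of (e : M ≃ₗ[ℤ] M) : M ≃ₗ[ℤ] LaurentModule e :=
  { AddEquiv.refl M with map_smul' := int_smul_eq_zsmul _ }

lemma LaurentModule.T_smul_of (e : M ≃ₗ[ℤ] M) (x : M) :
    (T 1 : ℤ[T;T⁻¹]) • of e x = of e (e x) :=
  T_smul e x

/-- The universal property of `LaurentModule e`: a homomorphism from `M` to a `ℤ[t, t⁻¹]`-module
which turns `e` into multiplication by `t` is `ℤ[t, t⁻¹]`-linear on `LaurentModule e`. -/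
def LaurentModule.lift {e : M ≃ₗ[ℤ] M} {N : Type*} [AddCommGroup N] [Module ℤ[T;T⁻¹] N]
    (g : M →ₗ[ℤ] N) (hg : ∀ x, g (e x) = (T 1 : ℤ[T;T⁻¹]) • g x) :
    LaurentModule e →ₗ[ℤ[T;T⁻¹]] N :=
  let g' := g ∘ₗ (of e).symm.toLinearMap
  { g' with
    map_smul' := map_laurent_smul_of_map_T_smul g'.toAddMonoidHom fun x =>
      (congrArg g' (T_smul_of e ((of e).symm x))).trans (hg ((of e).symm x)) }

/-- The isomorphism of `ℤ[t, t⁻¹]`-modules given by an isomorphism that intertwines two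
automorphisms. -/
def LaurentModule.congr {e : M ≃ₗ[ℤ] M} {e' : M' ≃ₗ[ℤ] M'} (ε : M ≃ₗ[ℤ] M')
    (h : ∀ x, ε (e x) = e' (ε x)) : LaurentModule e ≃ₗ[ℤ[T;T⁻¹]] LaurentModule e' :=
  LinearEquiv.ofBijective
    (lift ((of e').toLinearMap ∘ₗ ε.toLinearMap) fun x =>
      (congrArg (of e') (h x)).trans (T_smul_of e' (ε x)).symm)
    (((of e').bijective.comp ε.bijective).comp (of e).symm.bijective)

/-- The matrix `Hᵀ - tI` over `ℤ[t, t⁻¹]`, whose rows are the relations between the generators of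
`LaurentModule e` given by a basis in which `e` has the matrix `H`. -/
def transposeSubT {ι : Type*} [DecidableEq ι] (H : Matrix ι ι ℤ) : Matrix ι ι ℤ[T;T⁻¹] :=
  H.transpose.map (C : ℤ →+* ℤ[T;T⁻¹]) - (T 1 : ℤ[T;T⁻¹]) • 1

lemma map_transposeSubT_row {ι : Type*} [Fintype ι] [DecidableEq ι] {N : Type*} [AddCommGroup N]
    [Module ℤ[T;T⁻¹] N] (H : Matrix ι ι ℤ) (k : (ι → ℤ[T;T⁻¹]) →ₗ[ℤ[T;T⁻¹]] N) (j : ι) :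
    k (transposeSubT H j) =
      ∑ i, H i j • k (Pi.single i 1) - (T 1 : ℤ[T;T⁻¹]) • k (Pi.single j 1) := by
  have hrow : transposeSubT H j =
      ∑ i, H i j • Pi.single i (1 : ℤ[T;T⁻¹]) - (T 1 : ℤ[T;T⁻¹]) • Pi.single j 1 := by
    ext1 i
    simp [transposeSubT, Finset.sum_apply, Pi.single_apply, one_apply, eq_comm]
  simp only [hrow, map_sub, map_sum, map_zsmul, map_smul]

namespace LaurentModule

section Generators

variable {ι : Type*} [Fintype ι] {M : Type} [AddCommGroup M] (e : M ≃ₗ[ℤ] M)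
  (b : Module.Basis ι ℤ M)

/-- The generators of `LaurentModule e` given by a `ℤ`-basis of `M`. -/
def generators : (ι → ℤ[T;T⁻¹]) →ₗ[ℤ[T;T⁻¹]] LaurentModule e :=
  Fintype.linearCombination ℤ[T;T⁻¹] fun i => of e (b i)

lemma generators_surjective : Function.Surjective (generators e b) := by
  intro x
  obtain ⟨x, rfl⟩ := (of e).surjective x
  refine ⟨fun i => C (b.repr x i), ?_⟩
  simp only [generators, Fintype.linearCombination_apply, C_smul_eq_zsmul, ← map_smul, ← map_sum,
    b.sum_repr]

variable [DecidableEq ι]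

lemma generators_single (i : ι) : generators e b (Pi.single i 1) = of e (b i) := by
  rw [generators, Fintype.linearCombination_apply_single, one_smul]

lemma apply_basis_eq_sum (j : ι) : e (b j) = ∑ i, LinearMap.toMatrix b b e i j • b i := by
  have h := Matrix.toLin_self b b (LinearMap.toMatrix b b e) j
  rw [Matrix.toLin_toMatrix] at h
  exact h

lemma generators_transposeSubT_row (j : ι) :
    generators e b (transposeSubT (LinearMap.toMatrix b b e) j) = 0 := by
  simp only [map_transposeSubT_row, generators_single, T_smul_of, apply_basis_eq_sum e b j,
    map_sum, map_smul, sub_self]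

lemma exists_comp_generators_eq_mkQ :
    ∃ σ, σ ∘ₗ generators e b =
      (LinearMap.range (transposeSubT (LinearMap.toMatrix b b e)).vecMulLinear).mkQ := by
  set Q := transposeSubT (LinearMap.toMatrix b b e)
  set S := LinearMap.range Q.vecMulLinear
  let g : M →ₗ[ℤ] (ι → ℤ[T;T⁻¹]) ⧸ S := b.constr ℤ fun i => S.mkQ (Pi.single i 1)
  have hg_basis : ∀ i, g (b i) = S.mkQ (Pi.single i 1) := b.constr_basis ℤ _
  have hQ : ∀ j, S.mkQ (Q j) = 0 := fun j =>
    (Submodule.Quotient.mk_eq_zero S).2 ⟨Pi.single j 1, single_one_vecMul j Q⟩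
  have hg : g ∘ₗ e.toLinearMap = (LinearMap.lsmul ℤ[T;T⁻¹] _ (T 1)).restrictScalars ℤ ∘ₗ g := by
    refine b.ext fun j => ?_
    have hrel := hQ j
    rw [map_transposeSubT_row, sub_eq_zero] at hrel
    simp only [LinearMap.comp_apply, LinearEquiv.coe_coe, apply_basis_eq_sum e b j, map_sum,
      map_smul, hg_basis, hrel]
    rfl
  let σ : LaurentModule e →ₗ[ℤ[T;T⁻¹]] _ := lift g (LinearMap.congr_fun hg)
  exact ⟨σ, LinearMap.pi_ext' fun i => LinearMap.ext_ring <|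
    (congrArg σ (generators_single e b i)).trans (hg_basis i)⟩

lemma generators_exact :
    Function.Exact (transposeSubT (LinearMap.toMatrix b b e)).vecMulLinear (generators e b) := by
  set Q := transposeSubT (LinearMap.toMatrix b b e)
  obtain ⟨σ, hσ⟩ := exists_comp_generators_eq_mkQ e b
  have hzero : generators e b ∘ₗ Q.vecMulLinear = 0 :=
    LinearMap.pi_ext' fun j => LinearMap.ext_ring <|
      (congrArg (generators e b) (single_one_vecMul j Q)).trans (generators_transposeSubT_row e b j)
  refine fun x => ⟨fun hx => ?_, ?_⟩
  · have hmk := LinearMap.congr_fun hσ x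
    rw [LinearMap.comp_apply, hx, map_zero] at hmk
    exact (Submodule.Quotient.mk_eq_zero _).1 hmk.symm
  · rintro ⟨y, rfl⟩
    exact LinearMap.congr_fun hzero y

end Generators

theorem isPresentationMatrix_transposeSubT {μ : ℕ} (e : M ≃ₗ[ℤ] M)
    (b : Module.Basis (Fin μ) ℤ M) :
    IsPresentationMatrix (transposeSubT (LinearMap.toMatrix b b e)) (LaurentModule e) := by
  obtain rfl : ‹Module ℤ M› = AddCommGroup.toIntModule M := Subsingleton.elim _ _
  exact ⟨generators e b, generators_exact e b, generators_surjective e b⟩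

end LaurentModule

lemma associated_det_transposeSubT {ι : Type*} [Fintype ι] [DecidableEq ι] (H : Matrix ι ι ℤ) :
    Associated (transposeSubT H).det (Polynomial.toLaurent H.charpoly) := by
  have hneg : transposeSubT H =
      -(Polynomial.toLaurent (R := ℤ)).mapMatrix H.charmatrix.transpose := by
    ext i j : 1
    obtain rfl | hij := eq_or_ne i j
    · simp [transposeSubT]
    · simp [transposeSubT, hij, hij.symm]
  rw [hneg, det_neg, ← RingHom.map_det, det_transpose]
  exact associated_unit_mul_left _ _ ((IsUnit.neg isUnit_one).pow _)

end Laurent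

/-! ### Maps to the circle that are homotopic to one -/

section Lifting

open Metric

variable {A : Type*} [TopologicalSpace A]

lemma homotopic_circle_iff {φ ψ : C(A, Circle)} :
    φ.Homotopic ψ ↔ ∃ f : C(A, ℝ), ∀ x, φ x = ψ x * Circle.exp (f x) := by
  constructor
  · intro h
    obtain ⟨K⟩ := h.symm
    let K' : C(unitInterval × A, Circle) := ⟨fun p => K p / ψ p.2, by fun_prop⟩
    have hK' : ∀ x, K' (0, x) = Circle.exp ((0 : C(A, ℝ)) x) := fun x => by simp [K']
    let f := Circle.isCoveringMap_exp.liftHomotopy K' 0 hK'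
    have hf : ∀ p, Circle.exp (f p) = K' p :=
      congrFun (Circle.isCoveringMap_exp.liftHomotopy_lifts K' 0 hK')
    exact ⟨⟨fun x => f (1, x), by fun_prop⟩, fun x => by simp [hf, K']⟩
  · rintro ⟨f, hf⟩
    exact ⟨⟨⟨fun p => ψ p.2 * Circle.exp ((1 - p.1) * f p.2), by fun_prop⟩,
      fun x => by simp [hf], fun x => by simp⟩⟩

lemma homotopic_one_circle_iff {φ : C(A, Circle)} :
    φ.Homotopic 1 ↔ ∃ f : C(A, ℝ), ∀ x, φ x = Circle.exp (f x) := by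
  simp [homotopic_circle_iff]

lemma homotopic_circle_iff_div_homotopic_one {φ ψ : C(A, Circle)} :
    φ.Homotopic ψ ↔ (φ / ψ).Homotopic 1 := by
  simp [homotopic_circle_iff, div_eq_iff_eq_mul']

lemma exists_eqOn_add_const_of_circle_exp_eq {s : Set A} (hs : IsPreconnected s)
    {f g : A → ℝ} (hf : ContinuousOn f s) (hg : ContinuousOn g s)
    (h : ∀ x ∈ s, Circle.exp (f x) = Circle.exp (g x)) :
    ∃ c : ℝ, Circle.exp c = 1 ∧ s.EqOn f (fun x => g x + c) := by
  obtain rfl | ⟨x₀, hx₀⟩ := s.eq_empty_or_nonempty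
  · exact ⟨0, Circle.exp_zero, Set.eqOn_empty _ _⟩
  have hc : Circle.exp (f x₀ - g x₀) = 1 := by rw [Circle.exp_sub, h x₀ hx₀, div_self']
  refine ⟨f x₀ - g x₀, hc, Circle.isCoveringMap_exp.eqOn_of_comp_eqOn hs hf
    (hg.add continuousOn_const) (fun x hx => ?_) hx₀ (by simp)⟩
  simp [Circle.exp_add, hc, h x hx]

lemma homotopic_one_of_continuousOn_lifts {ψ : C(A, Circle)} {U V : Set A} (hU : IsOpen U)
    (hV : IsOpen V) (hUV : U ∪ V = Set.univ) (hconn : IsPreconnected (U ∩ V)) {f g : A → ℝ}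
    (hf : ContinuousOn f U) (hψf : ∀ x ∈ U, ψ x = Circle.exp (f x))
    (hg : ContinuousOn g V) (hψg : ∀ x ∈ V, ψ x = Circle.exp (g x)) : ψ.Homotopic 1 := by
  classical
  obtain ⟨c, hc, hfg⟩ := exists_eqOn_add_const_of_circle_exp_eq hconn
    (hf.mono Set.inter_subset_left) (hg.mono Set.inter_subset_right) fun x hx => by
      rw [← hψf x hx.1, hψg x hx.2]
  let k := U.piecewise f fun x => g x + c
  have hkU : U.EqOn k f := Set.piecewise_eqOn U _ _
  have hkV : V.EqOn k fun x => g x + c := fun x hx => by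
    by_cases hxU : x ∈ U
    · exact (hkU hxU).trans (hfg ⟨hxU, hx⟩)
    · exact Set.piecewise_eq_of_notMem _ _ _ hxU
  have hk : Continuous k := by
    rw [← continuousOn_univ, ← hUV]
    exact (hf.congr hkU).union_of_isOpen ((hg.add continuousOn_const).congr hkV) hU hV
  refine homotopic_one_circle_iff.2 ⟨⟨k, hk⟩, fun x => ?_⟩
  change ψ x = Circle.exp (k x)
  rcases (hUV ▸ Set.mem_univ x : x ∈ U ∪ V) with hx | hx
  · rw [hkU hx, hψf x hx]
  · rw [hkV hx, Circle.exp_add, hc, mul_one, hψg x hx]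

section Sphere

variable {E : Type*} [NormedAddCommGroup E] [InnerProductSpace ℝ E]

lemma exists_continuousOn_lift_compl_singleton_sphere (ψ : C(sphere (0 : E) 1, Circle))
    (v : sphere (0 : E) 1) :
    ∃ f : sphere (0 : E) 1 → ℝ, ContinuousOn f {v}ᶜ ∧ ∀ x ∈ ({v}ᶜ : Set _),
      ψ x = Circle.exp (f x) := by
  let e := stereographic (norm_eq_of_mem_sphere v)
  have hsource : e.source = {v}ᶜ := stereographic_source _
  have hsymm : Continuous e.symm := by
    simpa only [e, stereographic_target, continuousOn_univ] using e.continuousOn_symm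
  obtain ⟨s, hs⟩ := Circle.isAddQuotientCoveringMap_exp.surjective (ψ (e.symm 0))
  obtain ⟨F, ⟨-, hF⟩, -⟩ := Circle.isCoveringMap_exp.existsUnique_continuousMap_lifts
    (ψ.comp ⟨e.symm, hsymm⟩) 0 s hs
  refine ⟨F ∘ e, F.continuous.comp_continuousOn (hsource ▸ e.continuousOn), fun x hx => ?_⟩
  rw [← hsource] at hx
  simpa only [Function.comp_apply, ContinuousMap.comp_apply, ContinuousMap.coe_mk,
    e.left_inv hx] using (congrFun hF (e x)).symm

variable {n : ℕ} [Fact (Module.finrank ℝ E = n + 1)]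

lemma isPreconnected_compl_pair_sphere (hn : 1 < n) {v w : sphere (0 : E) 1} (hvw : v ≠ w) :
    IsPreconnected ({v}ᶜ ∩ {w}ᶜ : Set (sphere (0 : E) 1)) := by
  let e := stereographic' n v
  have hsource : e.source = {v}ᶜ := stereographic'_source v
  have htarget : e.target = Set.univ := stereographic'_target v
  have hw : w ∈ e.source := hsource ▸ hvw.symm
  have himage : ({v}ᶜ ∩ {w}ᶜ : Set (sphere (0 : E) 1)) = e.symm '' {e w}ᶜ := by
    rw [← hsource]
    ext x
    constructor
    · rintro ⟨hx, hxw⟩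
      exact ⟨e x, fun h => hxw (e.injOn hx hw h), e.left_inv hx⟩
    · rintro ⟨y, hy, rfl⟩
      have hy' : y ∈ e.target := htarget ▸ Set.mem_univ y
      refine ⟨e.map_target hy', fun h : e.symm y = w => hy ?_⟩
      rw [Set.mem_singleton_iff, ← h, e.right_inv hy']
  rw [himage]
  have hrank : 1 < Module.rank ℝ (EuclideanSpace ℝ (Fin n)) := by
    rw [← Module.finrank_eq_rank, finrank_euclideanSpace_fin]
    exact_mod_cast hn
  exact (isConnected_compl_singleton_of_one_lt_rank hrank (e w)).isPreconnected.image _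
    (e.continuousOn_symm.mono (htarget ▸ Set.subset_univ _))

lemma homotopic_one_of_sphere (hn : 1 < n) (ψ : C(sphere (0 : E) 1, Circle)) :
    ψ.Homotopic 1 := by
  have : Nontrivial E := Module.nontrivial_of_finrank_pos (R := ℝ) <| by
    rw [(Fact.out : Module.finrank ℝ E = n + 1)]
    omega
  obtain ⟨v⟩ : Nonempty (sphere (0 : E) 1) :=
    (NormedSpace.sphere_nonempty.2 zero_le_one).to_subtype
  have hne : v ≠ -v := ne_neg_of_mem_unit_sphere ℝ _
  obtain ⟨f, hf, hψf⟩ := exists_continuousOn_lift_compl_singleton_sphere ψ v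
  obtain ⟨g, hg, hψg⟩ := exists_continuousOn_lift_compl_singleton_sphere ψ (-v)
  refine homotopic_one_of_continuousOn_lifts isOpen_compl_singleton isOpen_compl_singleton ?_
    (isPreconnected_compl_pair_sphere hn hne) hf hψf hg hψg
  rw [← Set.compl_inter, (Set.disjoint_singleton.2 hne).inter_eq, Set.compl_empty]

end Sphere

lemma exists_eq_mul_exp_of_homotopic_one {W : Type*} [TopologicalSpace W] [PreconnectedSpace W]
    (w₀ : W) (g : C(Circle × W, Circle))
    (hg : (g.comp ((ContinuousMap.const W 1).prodMk (.id W))).Homotopic 1) :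
    ∃ b : C(Circle × W, ℝ), ∀ z w, g (z, w) = g (z, w₀) * Circle.exp (b (z, w)) := by
  let q : C(ℝ × W, Circle × W) := Circle.exp.prodMap (.id W)
  have hq : Topology.IsQuotientMap q :=
    (Circle.isAddQuotientCoveringMap_exp.isOpenQuotientMap.prodMap .id).isQuotientMap
  have hlift : (g.comp q).Homotopic 1 := by
    refine .trans ⟨⟨⟨fun p => g (Circle.exp ((1 - p.1) * p.2.1), p.2.2), by fun_prop⟩,
      fun x => ?_, fun x => by simp⟩⟩ (hg.comp (.refl ContinuousMap.snd))
    change g (_, _) = g (Circle.exp x.1, x.2)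
    simp
  obtain ⟨u, hu⟩ := homotopic_one_circle_iff.1 hlift
  -- subtracting the lift at `w₀` makes the lift on `ℝ × W` periodic in the first coordinate
  let c : C(ℝ × W, ℝ) := ⟨fun p => u p - u (p.1, w₀), by fun_prop⟩
  have hc : ∀ s w, Circle.exp (c (s, w)) = g (Circle.exp s, w) / g (Circle.exp s, w₀) :=
    fun s w => by
      simp only [c, ContinuousMap.coe_mk, Circle.exp_sub, ← hu]
      rfl
  have hfactor : Function.FactorsThrough c q := by
    rintro ⟨s, w⟩ ⟨t, w'⟩ h
    obtain ⟨hst : Circle.exp s = Circle.exp t, rfl : w = w'⟩ := Prod.ext_iff.1 h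
    have : (fun w => c (s, w)) = fun w => c (t, w) :=
      Circle.isCoveringMap_exp.eq_of_comp_eq (by fun_prop) (by fun_prop)
        (by ext1 w; simp only [Function.comp_apply, hc, hst]) w₀ (by simp [c])
    exact congrFun this w
  refine ⟨hq.lift c hfactor, fun z w => ?_⟩
  obtain ⟨s, rfl⟩ := Circle.isAddQuotientCoveringMap_exp.surjective z
  have : hq.lift c hfactor (q (s, w)) = c (s, w) :=
    DFunLike.congr_fun (hq.lift_comp c hfactor) (s, w)
  rw [show ((Circle.exp s, w) : Circle × W) = q (s, w) from rfl, this, hc]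
  exact (mul_div_cancel _ _).symm

end Lifting

/-! ### First homology of cyclic coverings -/

section Homology

open ContinuousMap

variable {X Y Z : Type} [TopologicalSpace X] [TopologicalSpace Y] [TopologicalSpace Z]

/-- The homomorphism induced by a continuous map on the first homology group. -/
def H1.map (f : C(X, Y)) : H1 X →ₗ[ℤ] H1 Y := (H1Functor.map (TopCat.ofHom f)).hom

lemma H1.map_id : H1.map (ContinuousMap.id X) = LinearMap.id := by
  rw [H1.map, TopCat.ofHom_id, CategoryTheory.Functor.map_id]
  rfl

lemma H1.map_comp (g : C(Y, Z)) (f : C(X, Y)) : H1.map (g.comp f) = H1.map g ∘ₗ H1.map f := by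
  rw [H1.map, TopCat.ofHom_comp, CategoryTheory.Functor.map_comp]
  rfl

lemma H1.map_eq_of_homotopic {f g : C(X, Y)} : f.Homotopic g → H1.map f = H1.map g := by
  rintro ⟨K⟩
  exact congrArg ModuleCat.Hom.hom <|
    TopCat.Homotopy.congr_homologyMap_singularChainComplexFunctor
      (f := TopCat.ofHom f) (g := TopCat.ofHom g) K (ModuleCat.of ℤ ℤ) 1

/-- The isomorphism of first homology groups induced by a homotopy equivalence. -/
def H1.congr (E : X ≃ₕ Y) : H1 X ≃ₗ[ℤ] H1 Y :=
  LinearEquiv.ofLinearMap (H1.map E.toFun) (H1.map E.invFun)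
    (by rw [← H1.map_comp, H1.map_eq_of_homotopic E.right_inv, H1.map_id])
    (by rw [← H1.map_comp, H1.map_eq_of_homotopic E.left_inv, H1.map_id])

/-- The isomorphism of `ℤ[t, t⁻¹]`-modules induced by a homotopy equivalence that intertwines two
homeomorphisms up to homotopy. -/
def H1.laurentCongr (a : X ≃ₜ X) (b : Y ≃ₜ Y) (E : X ≃ₕ Y)
    (hab : (E.toFun.comp (a : C(X, X))).Homotopic ((b : C(Y, Y)).comp E.toFun)) :
    LaurentModule (H1.aut a) ≃ₗ[ℤ[T;T⁻¹]] LaurentModule (H1.aut b) :=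
  LaurentModule.congr (H1.congr E) fun x => by
    have := H1.map_eq_of_homotopic hab
    rw [H1.map_comp, H1.map_comp] at this
    exact DFunLike.congr_fun this x

/-- The homotopy equivalence `x ↦ (x, 0)` from a space to its product with the line. -/
def homotopyEquivProdReal (F : Type*) [TopologicalSpace F] : F ≃ₕ F × ℝ where
  toFun := ⟨fun x => (x, 0), by fun_prop⟩
  invFun := ⟨Prod.fst, continuous_fst⟩
  left_inv := .refl _
  right_inv := ⟨⟨⟨fun p => (p.2.1, p.1 * p.2.2), by fun_prop⟩, by simp, by simp⟩⟩

lemma IsMonodromy.nonempty_linearEquiv {φ : C(X, Circle)} {h : fiber φ ≃ₜ fiber φ} :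
    IsMonodromy φ h → Nonempty (LaurentModule (H1.aut h) ≃ₗ[ℤ[T;T⁻¹]] AlexanderModule φ) := by
  rintro ⟨Ψ, -, -, hΨ⟩
  let E := (homotopyEquivProdReal (fiber φ)).trans Ψ.toHomotopyEquiv
  have hE : ∀ x, E.toFun x = Ψ (x, 0) := fun x => rfl
  refine ⟨H1.laurentCongr h (deckGenerator φ) E ?_⟩
  -- moving the height from `0` to `1` deforms `Ψ (h x, 0)` to `Ψ (h x, 1) = t (Ψ (x, 0))`
  exact ⟨⟨⟨fun p => Ψ (h p.2, p.1), by fun_prop⟩, fun x => by simp [hE],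
    fun x => by simp [hE, hΨ]⟩⟩

variable {φ ψ : C(X, Circle)}

/-- The homeomorphism `(x, r) ↦ (x, r + f x)` between the coverings defined by two maps that differ
by `exp (2πif)`. -/
def CyclicCover.translate (f : C(X, ℝ)) (hf : ∀ x, ψ x = φ x * Circle.exp (2 * Real.pi * f x)) :
    CyclicCover φ ≃ₜ CyclicCover ψ :=
  Homeomorph.subtype
    { toFun := fun p : X × ℝ => (p.1, p.2 + f p.1)
      invFun := fun p => (p.1, p.2 - f p.1)
      left_inv := fun p => by simp
      right_inv := fun p => by simp
      continuous_toFun := by fun_prop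
      continuous_invFun := by fun_prop }
    fun p => by
      change _ ↔ ψ p.1 = Circle.exp (2 * Real.pi * (p.2 + f p.1))
      rw [hf, mul_add, Circle.exp_add, mul_left_inj]

lemma CyclicCover.translate_deckGenerator (f : C(X, ℝ))
    (hf : ∀ x, ψ x = φ x * Circle.exp (2 * Real.pi * f x)) (p : CyclicCover φ) :
    translate f hf (deckGenerator φ p) = deckGenerator ψ (translate f hf p) :=
  Subtype.ext (Prod.ext rfl (add_right_comm _ _ _))

lemma AlexanderModule.nonempty_linearEquiv_of_homotopic (h : φ.Homotopic ψ) :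
    Nonempty (AlexanderModule φ ≃ₗ[ℤ[T;T⁻¹]] AlexanderModule ψ) := by
  obtain ⟨f, hf⟩ := homotopic_circle_iff.1 h.symm
  let f' : C(X, ℝ) := ⟨fun x => f x / (2 * Real.pi), by fun_prop⟩
  have hf' : ∀ x, ψ x = φ x * Circle.exp (2 * Real.pi * f' x) := fun x => by
    change ψ x = φ x * Circle.exp (2 * Real.pi * (f x / (2 * Real.pi)))
    rw [hf, mul_div_cancel₀ _ Real.two_pi_pos.ne']
  have hcomm : ((CyclicCover.translate f' hf' : C(_, _)).comp
      (deckGenerator φ : C(CyclicCover φ, CyclicCover φ))) =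
      (deckGenerator ψ : C(CyclicCover ψ, CyclicCover ψ)).comp
        (CyclicCover.translate f' hf' : C(_, _)) :=
    ContinuousMap.ext (CyclicCover.translate_deckGenerator f' hf')
  exact ⟨H1.laurentCongr _ _ (CyclicCover.translate f' hf').toHomotopyEquiv (hcomm ▸ .refl _)⟩

end Homology

/-! ### Maps on the exterior of a link -/

section Extension

open Topology

lemma exists_extension_of_union_isClosed {X Y P : Type*} [TopologicalSpace X] [TopologicalSpace Y]
    [TopologicalSpace P] {S : Set X} (hS : IsClosed S) {T : P → X} (hT : IsClosedEmbedding T)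
    (hST : S ∪ Set.range T = Set.univ) (ψ : C(S, Y)) (G : C(P, Y))
    (hG : ∀ p (x : S), T p = x → G p = ψ x) : ∃ F : C(X, Y), ∀ x : S, F x = ψ x := by
  let q : C(S ⊕ P, X) := ⟨Sum.elim Subtype.val T, continuous_subtype_val.sumElim hT.continuous⟩
  have hq : IsQuotientMap q := by
    refine (hS.isClosedMap_subtype_val.sumElim hT.isClosedMap).isQuotientMap q.continuous ?_
    rw [← Set.range_eq_univ, ← hST]
    simp
  let k : C(S ⊕ P, Y) := ⟨Sum.elim ψ G, ψ.continuous.sumElim G.continuous⟩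
  have hk : Function.FactorsThrough k q := by
    rintro (x | p) (x' | p') h
    · exact congrArg ψ (Subtype.ext h)
    · exact (hG p' x h.symm).symm
    · exact hG p x' h
    · exact congrArg G (hT.injective h)
  exact ⟨hq.lift k hk, fun x => DFunLike.congr_fun (hq.lift_comp k hk) (.inl x)⟩

lemma exists_extension_solidTorus (g : C(Circle × Circle, Circle))
    (hg : (g.comp ((ContinuousMap.const Circle 1).prodMk (.id Circle))).Homotopic 1) :
    ∃ G : C(Circle × ℂ, Circle), ∀ z w : Circle, G (z, w) = g (z, w) := by
  obtain ⟨b, hb⟩ := exists_eq_mul_exp_of_homotopic_one 1 g hg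
  have hcoe : IsClosedEmbedding ((↑) : Circle → ℂ) :=
    (show Continuous fun z : Circle => (z : ℂ) by fun_prop).isClosedEmbedding
      Circle.coe_injective
  obtain ⟨B, hB⟩ := ContinuousMap.exists_extension (IsClosedEmbedding.id.prodMap hcoe) b
  refine ⟨⟨fun p => g (p.1, 1) * Circle.exp (B p), by fun_prop⟩, fun z w => ?_⟩
  have : B (z, w) = b (z, w) := DFunLike.congr_fun hB (z, w)
  simp [hb z w, this]

end Extension

namespace TubularNeighborhood

open Metric

variable {n : ℕ} {L : OrientedLink n} (N : TubularNeighborhood L)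

lemma isClosed_exterior : IsClosed N.exterior :=
  (isOpen_iUnion fun i => (N.isOpenEmbedding i).isOpenMap _
    (isOpen_univ.prod Metric.isOpen_ball)).isClosed_compl

lemma one_le_norm_of_tube_mem_exterior {i : Fin n} {z : Circle} {w : ℂ}
    (h : N.tube i (z, w) ∈ N.exterior) : 1 ≤ ‖w‖ := by
  by_contra! hw
  exact h (Set.mem_iUnion.2 ⟨i, (z, w), ⟨Set.mem_univ z, by simpa using hw⟩, rfl⟩)

/-- The union of the closed tubes of radius one, parametrized by solid tori. -/
def closedTubes : C(Fin n × Circle × closedBall (0 : ℂ) 1, S3) where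
  toFun p := N.tube p.1 (p.2.1, p.2.2)
  continuous_toFun := continuous_prod_of_discrete_left.2 fun i =>
    (N.isOpenEmbedding i).continuous.comp (by fun_prop)

lemma closedTubes_injective : Function.Injective N.closedTubes := by
  rintro ⟨i, z, w⟩ ⟨j, z', w'⟩ h
  obtain rfl : i = j := by
    by_contra hij
    exact Set.disjoint_left.1 (N.disjoint hij) ⟨_, rfl⟩ ⟨_, h.symm⟩
  obtain ⟨hz, hw⟩ := Prod.ext_iff.1 ((N.isOpenEmbedding i).injective h)
  exact Prod.ext rfl (Prod.ext hz (Subtype.ext hw))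

lemma exterior_union_range_closedTubes : N.exterior ∪ Set.range N.closedTubes = Set.univ := by
  refine Set.eq_univ_of_forall fun x => or_iff_not_imp_left.2 fun hx => ?_
  simp only [exterior, Set.mem_compl_iff, not_not, Set.mem_iUnion] at hx
  obtain ⟨i, ⟨z, w⟩, ⟨-, hw⟩, rfl⟩ := hx
  exact ⟨(i, z, ⟨w, ball_subset_closedBall hw⟩), rfl⟩

/-- The boundary torus of the `i`-th tube, parametrized by longitude and meridian. -/
def boundaryTorus (i : Fin n) : C(Circle × Circle, N.exterior) where
  toFun p := ⟨N.tube i (p.1, p.2), N.tube_mem_exterior i p.1 p.2 p.2.norm_coe⟩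
  continuous_toFun :=
    Continuous.subtype_mk ((N.isOpenEmbedding i).continuous.comp (by fun_prop)) _

lemma exists_extension (ψ : C(N.exterior, Circle))
    (hψ : ∀ i, (ψ.comp (N.meridian i)).Homotopic 1) :
    ∃ ψ' : C(S3, Circle), ∀ x : N.exterior, ψ' x = ψ x := by
  choose G hG using fun i => exists_extension_solidTorus (ψ.comp (N.boundaryTorus i)) (hψ i)
  let G' : C(Fin n × Circle × closedBall (0 : ℂ) 1, Circle) :=
    ⟨fun p => G p.1 (p.2.1, p.2.2), continuous_prod_of_discrete_left.2 fun i => by fun_prop⟩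
  refine exists_extension_of_union_isClosed N.isClosed_exterior
    (N.closedTubes.continuous.isClosedEmbedding N.closedTubes_injective)
    N.exterior_union_range_closedTubes ψ G' ?_
  rintro ⟨i, z, w, hw⟩ ⟨_, hp⟩ rfl
  have hw1 : ‖w‖ = 1 :=
    le_antisymm (by simpa using hw) (N.one_le_norm_of_tube_mem_exterior hp)
  exact hG i z ⟨w, by simpa [Submonoid.unitSphere] using hw1⟩

lemma homotopic_of_mem_homotopyClass {m : Fin n → ℤ} {φ φ₀ : C(N.exterior, Circle)}
    (hφ : φ ∈ homotopyClass N m) (hφ₀ : φ₀ ∈ homotopyClass N m) : φ.Homotopic φ₀ := by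
  obtain ⟨ψ, hψ⟩ := N.exists_extension (φ / φ₀) fun i =>
    homotopic_circle_iff_div_homotopic_one.1 ((hφ i).trans (hφ₀ i).symm)
  have : Fact (Module.finrank ℝ (EuclideanSpace ℝ (Fin 4)) = 3 + 1) := ⟨by simp⟩
  let ι : C(N.exterior, S3) := ⟨Subtype.val, continuous_subtype_val⟩
  have hψι : ψ.comp ι = φ / φ₀ := ContinuousMap.ext hψ
  rw [homotopic_circle_iff_div_homotopic_one, ← hψι]
  exact (homotopic_one_of_sphere (n := 3) (by norm_num) ψ).comp (.refl ι)

end TubularNeighborhood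

/-! ### Locally trivial maps pulled back to a line -/

section LocallyTrivial

open Bundle

variable {Z B C G : Type*} [TopologicalSpace Z] [TopologicalSpace B] [TopologicalSpace G]

/-- The family of the fibers of `p`, as a type family over the base. Its total space is
homeomorphic to the domain of `p`, which makes the theory of `FiberBundle`, stated for type
families, available for `p`. -/
def FiberFamily (p : Z → B) (b : B) : Type _ := {z : Z // p z = b}

instance (p : Z → B) (b : B) : TopologicalSpace (FiberFamily p b) :=
  inferInstanceAs (TopologicalSpace {z : Z // p z = b})

instance (p : Z → B) : TopologicalSpace (TotalSpace G (FiberFamily p)) :=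
  .induced (fun q => q.2.1) inferInstance

/-- The homeomorphism from the total space of the family of the fibers of `p` to the domain
of `p`. -/
def FiberFamily.totalSpaceHomeomorph (p : Z → B) : TotalSpace G (FiberFamily p) ≃ₜ Z where
  toFun q := q.2.1
  invFun z := ⟨p z, z, rfl⟩
  left_inv := by rintro ⟨b, z, rfl⟩; rfl
  right_inv _ := rfl
  continuous_toFun := continuous_induced_dom
  continuous_invFun := continuous_induced_rng.2 continuous_id

lemma FiberFamily.exists_trivialization {p : Z → B}
    (hp : ∀ b, ∃ e : Trivialization G p, b ∈ e.baseSet) (b : B) :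
    ∃ e : Trivialization G (TotalSpace.proj : TotalSpace G (FiberFamily p) → B),
      b ∈ e.baseSet := by
  have hproj : p ∘ totalSpaceHomeomorph (G := G) p = TotalSpace.proj := funext fun q => q.2.2
  obtain ⟨e, he⟩ := hp b
  rw [← hproj]
  exact ⟨e.compHomeomorph (totalSpaceHomeomorph p), he⟩

/-- The bundle structure on the family of the fibers of a locally trivial map. -/
abbrev FiberFamily.fiberBundle {p : Z → B}
    (hp : ∀ b, ∃ e : Trivialization G p, b ∈ e.baseSet) : FiberBundle G (FiberFamily p) where
  totalSpaceMk_isInducing' b :=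
    ⟨(induced_compose (f := TotalSpace.mk b) (g := totalSpaceHomeomorph p)).symm⟩
  trivializationAtlas' := Set.range fun b => (exists_trivialization hp b).choose
  trivializationAt' b := (exists_trivialization hp b).choose
  mem_baseSet_trivializationAt' b := (exists_trivialization hp b).choose_spec
  trivialization_mem_atlas' b := ⟨b, rfl⟩

/-- The homeomorphism from the fiber product of `p` and `f` to the pullback along `f` of the family
of the fibers of `p`. -/
def FiberFamily.pullbackHomeomorph [TopologicalSpace C] (p : Z → B) (f : C(C, B)) :
    Function.Pullback p f ≃ₜ TotalSpace G ((f : C → B) *ᵖ (FiberFamily p)) where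
  toFun q := ⟨q.1.2, q.1.1, q.2⟩
  invFun q := ⟨(q.2.1, q.1), q.2.2⟩
  left_inv _ := rfl
  right_inv _ := rfl
  continuous_toFun := by
    rw [(inducing_pullbackTotalSpaceEmbedding G (FiberFamily p) f).continuous_iff]
    exact (continuous_snd.comp continuous_subtype_val).prodMk
      (continuous_induced_rng.2 (continuous_fst.comp continuous_subtype_val))
  continuous_invFun :=
    (((totalSpaceHomeomorph p).continuous.comp (Pullback.continuous_lift G _ f)).prodMk
      (Pullback.continuous_proj G _ f)).subtype_mk _

lemma exists_trivialization_pullback_Icc_subset [ConditionallyCompleteLinearOrder C]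
    [TopologicalSpace C] [OrderTopology C] [Nonempty G] {p : Z → B}
    (hp : ∀ b, ∃ e : Trivialization G p, b ∈ e.baseSet) (f : C(C, B)) (a b : C) :
    ∃ e : Trivialization G (Function.Pullback.snd : Function.Pullback p f → C),
      Set.Icc a b ⊆ e.baseSet := by
  let _ : FiberBundle G (FiberFamily p) := FiberFamily.fiberBundle hp
  have (b : B) : Nonempty (FiberFamily p b) := by
    obtain ⟨e, he⟩ := hp b
    exact ⟨_, e.proj_symm_apply' (x := Classical.arbitrary G) he⟩
  obtain ⟨e, he⟩ :=
    FiberBundle.exists_trivialization_Icc_subset G ((f : C → B) *ᵖ (FiberFamily p)) a b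
  exact ⟨e.compHomeomorph (FiberFamily.pullbackHomeomorph p f), he⟩

end LocallyTrivial

/-! ### Equivariant maps between spaces over the line -/

section Equivariant

open Filter

lemma continuous_of_continuousOn_preimage_Icc {Y Z : Type*} [TopologicalSpace Y]
    [TopologicalSpace Z] {u : Y → ℝ} (hu : Continuous u) {f : Y → Z}
    (hf : ∀ k : ℤ, ContinuousOn f (u ⁻¹' Set.Icc k (k + 1))) : Continuous f := by
  have hfin : LocallyFinite fun k : ℤ => Set.Icc (k : ℝ) (k + 1) :=
    locallyFinite_Icc_of_tendsto tendsto_intCast_atTop_atTop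
      (tendsto_atBot_add_const_right _ _ (tendsto_intCast_atBot_iff.2 tendsto_id))
  refine (hfin.preimage_continuous hu).continuous ?_ (fun k => isClosed_Icc.preimage hu) hf
  rw [← Set.preimage_iUnion, iUnion_Icc_intCast, Set.preimage_univ]

lemma floor_eq_or_of_mem_Icc {k : ℤ} {r : ℝ} (hr : r ∈ Set.Icc (k : ℝ) (k + 1)) :
    ⌊r⌋ = k ∨ r = k + 1 :=
  hr.2.lt_or_eq.imp_left fun h => Int.floor_eq_iff.2 ⟨hr.1, h⟩

variable {Y Z : Type*} [TopologicalSpace Y] [TopologicalSpace Z] {u : Y → ℝ} {v : Z → ℝ}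
  {D : Y ≃ₜ Y} {E : Z ≃ₜ Z}

lemma height_zpow_apply (hD : ∀ y, u (D y) = u y + 1) (k : ℤ) (y : Y) :
    u ((D ^ k) y) = u y + k := by
  induction k generalizing y with
  | zero => simp
  | succ k ih =>
    rw [zpow_add_one, Homeomorph.mul_apply, ih, hD]
    push_cast
    ring
  | pred k ih =>
    have hD' : u (D⁻¹ y) = u y - 1 := eq_sub_of_add_eq <| by
      rw [← hD, ← Homeomorph.mul_apply, mul_inv_cancel, Homeomorph.one_apply]
    rw [zpow_sub_one, Homeomorph.mul_apply, ih, hD']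
    push_cast
    ring

lemma zpow_apply_zpow_neg_apply (D : Y ≃ₜ Y) (k : ℤ) (y : Y) : (D ^ k) ((D ^ (-k)) y) = y := by
  rw [← Homeomorph.mul_apply, ← zpow_add, add_neg_cancel, zpow_zero, Homeomorph.one_apply]

/-- The extension to `Y` of a map `θ` given on the fundamental domain `u ∈ [0, 1]` of the action of
`D`, equivariant with respect to `D` and `E`. -/
def equivariantExtension (u : Y → ℝ) (D : Y ≃ₜ Y) (E : Z ≃ₜ Z) (θ : Y → Z) (y : Y) : Z :=
  (E ^ ⌊u y⌋) (θ ((D ^ (-⌊u y⌋)) y))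

lemma zpow_neg_floor_mem (hD : ∀ y, u (D y) = u y + 1) (y : Y) :
    (D ^ (-⌊u y⌋)) y ∈ u ⁻¹' Set.Icc 0 1 := by
  rw [Set.mem_preimage, height_zpow_apply hD, Int.cast_neg, ← sub_eq_add_neg]
  exact ⟨Int.fract_nonneg _, (Int.fract_lt_one _).le⟩

section

variable (hD : ∀ y, u (D y) = u y + 1) {θ : Y → Z} (hθ : ∀ y, u y = 0 → θ (D y) = E (θ y))
include hD

lemma equivariantExtension_apply_deck (y : Y) :
    equivariantExtension u D E θ (D y) = E (equivariantExtension u D E θ y) := by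
  have h : (D ^ (-(⌊u y⌋ + 1))) (D y) = (D ^ (-⌊u y⌋)) y := by
    rw [← Homeomorph.mul_apply, ← zpow_add_one]
    congr 2
    ring
  simp only [equivariantExtension, hD, Int.floor_add_one]
  rw [h, add_comm, zpow_one_add, Homeomorph.mul_apply]

lemma height_equivariantExtension (hE : ∀ z, v (E z) = v z + 1)
    (hv : ∀ y ∈ u ⁻¹' Set.Icc 0 1, v (θ y) = u y) (y : Y) :
    v (equivariantExtension u D E θ y) = u y := by
  rw [equivariantExtension, height_zpow_apply hE, hv _ (zpow_neg_floor_mem hD y),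
    height_zpow_apply hD, Int.cast_neg, neg_add_cancel_right]

lemma equivariantExtension_leftInverse (hE : ∀ z, v (E z) = v z + 1)
    (hv : ∀ y ∈ u ⁻¹' Set.Icc 0 1, v (θ y) = u y) {θ' : Z → Y}
    (hθ' : Set.LeftInvOn θ' θ (u ⁻¹' Set.Icc 0 1)) :
    Function.LeftInverse (equivariantExtension v E D θ') (equivariantExtension u D E θ) := by
  intro y
  have h : (E ^ (-⌊u y⌋)) (equivariantExtension u D E θ y) = θ ((D ^ (-⌊u y⌋)) y) := by
    simpa only [equivariantExtension, neg_neg] using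
      zpow_apply_zpow_neg_apply E (-⌊u y⌋) (θ ((D ^ (-⌊u y⌋)) y))
  rw [equivariantExtension, height_equivariantExtension hD hE hv, h,
    hθ' (zpow_neg_floor_mem hD y), zpow_apply_zpow_neg_apply]

include hθ

lemma equivariantExtension_eq {k : ℤ} {y : Y} (hy : u y ∈ Set.Icc (k : ℝ) (k + 1)) :
    equivariantExtension u D E θ y = (E ^ k) (θ ((D ^ (-k)) y)) := by
  rcases floor_eq_or_of_mem_Icc hy with h | h
  · rw [equivariantExtension, h]
  · have hk : ⌊u y⌋ = k + 1 := by rw [h, Int.floor_add_one, Int.floor_intCast]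
    have hk' : (D ^ (-k)) y = D ((D ^ (-(k + 1))) y) := by
      rw [← Homeomorph.mul_apply, ← zpow_one_add]
      congr 2
      ring
    have h0 : u ((D ^ (-(k + 1))) y) = 0 := by
      rw [height_zpow_apply hD, h]
      push_cast
      ring
    rw [equivariantExtension, hk, hk', hθ _ h0, zpow_add_one, Homeomorph.mul_apply]

lemma continuous_equivariantExtension (hu : Continuous u)
    (hc : ContinuousOn θ (u ⁻¹' Set.Icc 0 1)) : Continuous (equivariantExtension u D E θ) := by
  refine continuous_of_continuousOn_preimage_Icc hu fun k => ?_
  refine ContinuousOn.congr ?_ fun y hy => equivariantExtension_eq hD hθ hy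
  refine (E ^ k).continuous.comp_continuousOn
    (hc.comp (D ^ (-k)).continuous.continuousOn fun y hy => ?_)
  rw [Set.mem_preimage, height_zpow_apply hD, Int.cast_neg, ← sub_eq_add_neg]
  exact ⟨sub_nonneg.2 hy.1, sub_le_iff_le_add'.2 hy.2⟩

end

lemma exists_equivariant_homeomorph (hu : Continuous u) (hv : Continuous v)
    (hD : ∀ y, u (D y) = u y + 1) (hE : ∀ z, v (E z) = v z + 1) (θ : PartialEquiv Y Z)
    (hsource : θ.source = u ⁻¹' Set.Icc 0 1) (htarget : θ.target = v ⁻¹' Set.Icc 0 1)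
    (hc : ContinuousOn θ θ.source) (hc' : ContinuousOn θ.symm θ.target)
    (hθv : ∀ y ∈ θ.source, v (θ y) = u y) (hθ : ∀ y, u y = 0 → θ (D y) = E (θ y)) :
    ∃ Ψ : Y ≃ₜ Z, (∀ y, v (Ψ y) = u y) ∧ ∀ y, Ψ (D y) = E (Ψ y) := by
  have hθu : ∀ z ∈ θ.target, u (θ.symm z) = v z := fun z hz => by
    rw [← hθv _ (θ.map_target hz), θ.right_inv hz]
  have hθ' : ∀ z, v z = 0 → θ.symm (E z) = D (θ.symm z) := fun z hz => by
    have hz' : z ∈ θ.target := by simp [htarget, hz]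
    have h0 : u (θ.symm z) = 0 := (hθu z hz').trans hz
    have h1 : D (θ.symm z) ∈ θ.source := by simp [hsource, hD, h0]
    rw [← θ.left_inv h1, hθ _ h0, θ.right_inv hz']
  have hinv := θ.leftInvOn
  have hinv' := θ.rightInvOn
  rw [hsource] at hc hθv hinv
  rw [htarget] at hc' hθu hinv'
  exact ⟨{
      toFun := equivariantExtension u D E θ
      invFun := equivariantExtension v E D θ.symm
      left_inv := equivariantExtension_leftInverse hD hE hθv hinv
      right_inv := equivariantExtension_leftInverse hE hD hθu hinv'
      continuous_toFun := continuous_equivariantExtension hD hθ hu hc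
      continuous_invFun := continuous_equivariantExtension hE hθ' hv hc' },
    height_equivariantExtension hD hE hθv, equivariantExtension_apply_deck hD⟩

end Equivariant

section MappingTorus

open Bundle

variable {Y G : Type*} [TopologicalSpace Y] [TopologicalSpace G]

variable {u : Y → ℝ} {D : Y ≃ₜ Y} (hD : ∀ y, u (D y) = u y + 1) (e : Trivialization G u)
include hD

lemma exists_gluing_homeomorph (h0 : 0 ∈ e.baseSet) (h1 : 1 ∈ e.baseSet) :
    ∃ η : G ≃ₜ G, ∀ y, u y = 0 → e (D y) = (1, η (e y).2) := by
  let D₀₁ : u ⁻¹' {0} ≃ₜ u ⁻¹' {1} := D.subtype fun y => by simp [hD]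
  refine ⟨(e.preimageSingletonHomeomorph h0).symm.trans
    (D₀₁.trans (e.preimageSingletonHomeomorph h1)), fun y hy => ?_⟩
  have huD : u (D y) = 1 := by rw [hD, hy, zero_add]
  have hey : e.toOpenPartialHomeomorph.symm (0, (e y).2) = y :=
    hy ▸ e.symm_apply_mk_proj (e.mem_source.2 (hy ▸ h0))
  refine Prod.ext ((e.coe_fst (e.mem_source.2 (huD ▸ h1))).trans huD) ?_
  exact congrArg (fun y => (e (D y)).2) hey.symm

lemma exists_homeomorph_prod_of_trivialization (hu : Continuous u)
    (he : Set.Icc 0 1 ⊆ e.baseSet) :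
    ∃ (η : G ≃ₜ G) (Ψ : Y ≃ₜ ℝ × G),
      (∀ y, (Ψ y).1 = u y) ∧ ∀ y, Ψ (D y) = ((Ψ y).1 + 1, η (Ψ y).2) := by
  obtain ⟨η, hη⟩ := exists_gluing_homeomorph hD e (he ⟨le_rfl, zero_le_one⟩)
    (he ⟨zero_le_one, le_rfl⟩)
  let θ : PartialEquiv Y (ℝ × G) := e.toPartialEquiv.restr (u ⁻¹' Set.Icc 0 1)
  have hsource : θ.source = u ⁻¹' Set.Icc 0 1 :=
    Set.inter_eq_right.2 fun y hy => e.mem_source.2 (he hy)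
  have htarget : θ.target = Prod.fst ⁻¹' Set.Icc 0 1 := by
    refine Set.Subset.antisymm (fun p hp => ?_) fun p hp => ?_
    · have hp' : u (e.toOpenPartialHomeomorph.symm p) ∈ Set.Icc (0 : ℝ) 1 := hp.2
      rwa [e.proj_symm_apply hp.1] at hp'
    · have hp' : p ∈ e.target := e.mem_target.2 (he hp)
      refine ⟨hp', show u (e.toOpenPartialHomeomorph.symm p) ∈ Set.Icc (0 : ℝ) 1 from ?_⟩
      rwa [e.proj_symm_apply hp']
  have hglue (y : Y) (hy : u y = 0) : e (D y) = ((e y).1 + 1, η (e y).2) := by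
    rw [hη y hy, e.coe_fst (hsource.ge (by simp [hy])).1, hy, zero_add]
  obtain ⟨Ψ, hΨ⟩ := exists_equivariant_homeomorph hu continuous_fst hD
    (E := (Homeomorph.addRight 1).prodCongr η) (fun _ => rfl) θ hsource htarget
    (e.toOpenPartialHomeomorph.continuousOn.mono Set.inter_subset_left)
    (e.toOpenPartialHomeomorph.continuousOn_symm.mono Set.inter_subset_left)
    (fun y hy => e.coe_fst hy.1) hglue
  exact ⟨η, Ψ, hΨ⟩

end MappingTorus

/-! ### Existence of a monodromy -/

section Monodromy

open Bundle

variable {X : Type} [TopologicalSpace X] {φ : C(X, Circle)}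

lemma CyclicCover.continuous_height : Continuous fun p : CyclicCover φ => p.1.2 :=
  continuous_snd.comp continuous_subtype_val

lemma CyclicCover.exists_trivialization_height {G : Type*} [TopologicalSpace G]
    [Nonempty G] (hφ : ∀ b : Circle, ∃ e : Trivialization G (φ : X → Circle), b ∈ e.baseSet)
    (a b : ℝ) : ∃ e : Trivialization G (fun p : CyclicCover φ => p.1.2), Set.Icc a b ⊆ e.baseSet :=
  exists_trivialization_pullback_Icc_subset hφ
    ⟨fun r : ℝ => Circle.exp (2 * Real.pi * r), by fun_prop⟩ a b

lemma CyclicCover.apply_eq_one {p : CyclicCover φ} (hp : p.1.2 = 0) : φ p.1.1 = 1 := by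
  rw [p.2, hp, mul_zero, Circle.exp_zero]

lemma CyclicCover.fiberInclusion_eq {p : CyclicCover φ} (hp : p.1.2 = 0) :
    fiberInclusion φ ⟨p.1.1, apply_eq_one hp⟩ = p :=
  Subtype.ext (Prod.ext rfl hp.symm)

/-- The homeomorphism from the fiber to the second factor of a product structure on the infinite
cyclic covering. -/
def fiberHomeomorph {G : Type*} [TopologicalSpace G] (Ψ : CyclicCover φ ≃ₜ ℝ × G)
    (hΨ : ∀ p, (Ψ p).1 = p.1.2) : fiber φ ≃ₜ G :=
  have height_symm (g : G) : (Ψ.symm (0, g)).1.2 = 0 := by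
    rw [← hΨ, Ψ.apply_symm_apply]
  { toFun := fun x => (Ψ (fiberInclusion φ x)).2
    invFun := fun g => ⟨(Ψ.symm (0, g)).1.1, CyclicCover.apply_eq_one (height_symm g)⟩
    left_inv := fun x => by
      have h : Ψ.symm (0, (Ψ (fiberInclusion φ x)).2) = fiberInclusion φ x :=
        Ψ.symm_apply_eq.2 (Prod.ext (hΨ (fiberInclusion φ x)).symm rfl)
      exact Subtype.ext (congrArg (fun p : CyclicCover φ => p.1.1) h)
    right_inv := fun g => by
      dsimp only
      rw [CyclicCover.fiberInclusion_eq (height_symm g), Ψ.apply_symm_apply]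
    continuous_toFun := continuous_snd.comp <|
      Ψ.continuous.comp <| (continuous_subtype_val.prodMk continuous_const).subtype_mk _
    continuous_invFun := (continuous_fst.comp <| continuous_subtype_val.comp <|
      Ψ.symm.continuous.comp <| by fun_prop).subtype_mk _ }

lemma exists_isMonodromy_of_homeomorph_prod {G : Type*} [TopologicalSpace G] {η : G ≃ₜ G}
    (Ψ : CyclicCover φ ≃ₜ ℝ × G) (hΨ : ∀ p, (Ψ p).1 = p.1.2)
    (hη : ∀ p, Ψ (deckGenerator φ p) = ((Ψ p).1 + 1, η (Ψ p).2)) :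
    ∃ h : fiber φ ≃ₜ fiber φ, IsMonodromy φ h := by
  let κ := fiberHomeomorph Ψ hΨ
  refine ⟨κ.trans (η.trans κ.symm),
    (κ.prodCongr (.refl ℝ)).trans ((Homeomorph.prodComm G ℝ).trans Ψ.symm),
    fun x z => ?_, fun x => ?_, fun x z => ?_⟩
  · exact (hΨ _).symm.trans (congrArg Prod.fst (Ψ.apply_symm_apply (z, κ x)))
  · exact Ψ.symm_apply_eq.2 (Prod.ext (hΨ (fiberInclusion φ x)).symm rfl)
  · apply Ψ.injective
    change Ψ (deckGenerator φ (Ψ.symm (z, κ x))) =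
      Ψ (Ψ.symm (z + 1, κ (κ.symm (η (κ x)))))
    simp only [hη, Homeomorph.apply_symm_apply]

theorem IsLocallyTrivialFibration.exists_isMonodromy (hφ : IsLocallyTrivialFibration φ) :
    ∃ h : fiber φ ≃ₜ fiber φ, IsMonodromy φ h := by
  obtain ⟨G, _, hG⟩ := hφ
  rcases isEmpty_or_nonempty G with _ | _
  · have : IsEmpty X := ⟨fun x => isEmptyElim ((hG (φ x)).choose x).2⟩
    have : IsEmpty (CyclicCover φ) := ⟨fun p => isEmptyElim p.1.1⟩
    exact ⟨.refl _, .empty, fun x => isEmptyElim x.1, fun x => isEmptyElim x.1,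
      fun x => isEmptyElim x.1⟩
  · obtain ⟨e, he⟩ := CyclicCover.exists_trivialization_height hG 0 1
    obtain ⟨η, Ψ, hΨ, hη⟩ := exists_homeomorph_prod_of_trivialization
      (D := deckGenerator φ) (fun _ => rfl) e CyclicCover.continuous_height he
    exact exists_isMonodromy_of_homeomorph_prod Ψ hΨ hη

end Monodromy

/-! ### The Alexander module of a fibered multilink -/

theorem mainTheorem5_general {X : Type} [TopologicalSpace X] {φ φ₀ : C(X, Circle)}
    (hfib : IsLocallyTrivialFibration φ) (hφ : φ.Homotopic φ₀) :
    (∃ h : fiber φ ≃ₜ fiber φ, IsMonodromy φ h) ∧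
    ∀ h : fiber φ ≃ₜ fiber φ, IsMonodromy φ h →
      ∀ (μ : ℕ) (b : Module.Basis (Fin μ) ℤ (H1 (fiber φ))) (H : Matrix (Fin μ) (Fin μ) ℤ),
        H = LinearMap.toMatrix b b (H1.aut h).toLinearMap →
        IsPresentationMatrix
          (H.transpose.map (LaurentPolynomial.C : ℤ →+* LaurentPolynomial ℤ)
            - (LaurentPolynomial.T 1 : LaurentPolynomial ℤ) • 1)
          (AlexanderModule φ₀) ∧
        IsAlexanderPolynomial (AlexanderModule φ₀) (Polynomial.toLaurent H.charpoly) := by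
  refine ⟨hfib.exists_isMonodromy, ?_⟩
  rintro h hh μ b H rfl
  obtain ⟨ε⟩ := hh.nonempty_linearEquiv
  obtain ⟨ε₀⟩ := AlexanderModule.nonempty_linearEquiv_of_homotopic hφ
  have hP := (LaurentModule.isPresentationMatrix_transposeSubT (H1.aut h) b).congr (ε.trans ε₀)
  exact ⟨hP, hP.isAlexanderPolynomial (associated_det_transposeSubT _)⟩

end

theorem mainTheorem5 {n : ℕ} (L : Multilink n) (N : TubularNeighborhood L.toOrientedLink)
    (φ : C(N.exterior, Circle)) (hφ : φ ∈ homotopyClass N L.mult)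
    (hfib : IsLocallyTrivialFibration φ)
    (φ₀ : C(N.exterior, Circle)) (hφ₀ : φ₀ ∈ homotopyClass N L.mult) :
    (∃ h : fiber φ ≃ₜ fiber φ, IsMonodromy φ h) ∧
    ∀ h : fiber φ ≃ₜ fiber φ, IsMonodromy φ h →
      ∀ (μ : ℕ) (b : Module.Basis (Fin μ) ℤ (H1 (fiber φ))) (H : Matrix (Fin μ) (Fin μ) ℤ),
        H = LinearMap.toMatrix b b (H1.aut h).toLinearMap →
        IsPresentationMatrix
          (H.transpose.map (LaurentPolynomial.C : ℤ →+* LaurentPolynomial ℤ)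
            - (LaurentPolynomial.T 1 : LaurentPolynomial ℤ) • 1)
          (AlexanderModule φ₀) ∧
        IsAlexanderPolynomial (AlexanderModule φ₀) (Polynomial.toLaurent H.charpoly) :=
  mainTheorem5_general hfib (N.homotopic_of_mem_homotopyClass hφ hφ₀)
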